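/- Let $R\ge 1$ and $I_1,\dots,I_4\ge 1$, and let $\alpha,a_\tau,b_\tau,a_\lambda,b_\lambda>0$ (for instance $a_\tau=\alpha R$, $b_\tau=\alpha R^{1/4}$). For $h=1,\dots,4$ and $r=1,\dots,R$ let $\boldsymbol\beta_h^{(r)}\in\mathbb R^{I_h}$ be the marginals of the PARAFAC($R$) tensor $\mathcal B=\sum_{r=1}^R\boldsymbol\beta_1^{(r)}\circ\boldsymbol\beta_2^{(r)}\circ\boldsymbol\beta_3^{(r)}\circ\boldsymbol\beta_4^{(r)}$, with the hierarchical global--local prior (Gamma laws in shape--rate form) $$\boldsymbol\phi\sim\mathrm{Dir}(\alpha,\dots,\alpha),\quad \tau\sim\mathrm{Ga}(a_\tau,b_\tau),\quad \lambda_{h,r}\sim\mathrm{Ga}(a_\lambda,b_\lambda),\quad w_{h,r,l}\mid\lambda_{h,r}\sim\mathrm{Exp}(\lambda_{h,r}^2/2),$$ $$\boldsymbol\beta_h^{(r)}\mid \mathbf W,\boldsymbol\phi,\tau\ \sim\ \mathcal N_{I_h}(\mathbf 0,\tau\phi_r W_{h,r}),\qquad W_{h,r}=\mathrm{diag}(w_{h,r,1},\dots,w_{h,r,I_h}),$$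 where $\boldsymbol\phi$, $\tau$ and $(\lambda,w)$ are independent, the $\lambda_{h,r}$ are independent, the $w_{h,r,l}$ are conditionally independent given $\lambda$, and the $\boldsymbol\beta_h^{(r)}$ are conditionally independent given $(\tau,\boldsymbol\phi,\mathbf W)$. Fix $(i,j,k,p)$, put $(m_1,m_2,m_3,m_4)=(i,j,k,p)$, and write the entry $b_{ijkp}$ of $\mathcal B$ as $b_{ijkp}=\sum_{r=1}^R\beta_r$ with $\beta_r=\prod_{h=1}^4\beta^{(r)}_{h,m_h}$. Then, for almost every value of $(\tau,\boldsymbol\phi,\mathbf W)$, all of $\tau$, $\phi_r$, $w_{h,r,l}$ are positive, and the conditional law of $b_{ijkp}$ given $(\tau,\boldsymbol\phi,\mathbf W)$ is the convolution of the conditional laws of $\beta_1,\dots,\beta_R$; it has the density $$\pi(\cdot\mid\tau,\boldsymbol\phi,\mathbf W)=p_1*\dots*p_R ,$$ where $p_r$, the conditional density of $\beta_r$ given $(\tau,\boldsymbol\phi,\mathbf W)$, is, for $x\neq0$, $$p_r(x)=K_r\; G^{4,0}_{0,4}\Bigl(x^2\prod_{h=1}^4(2\tau\phi_r w_{h,r,m_h})^{-1}\Bigm|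 0,0,0,0\Bigr),\qquad K_r=(2\pi)^{-4/2}\prod_{h=1}^4(\tau\phi_r w_{h,r,m_h})^{-1/2}.$$ Here $G^{4,0}_{0,4}$ is the Meijer G-function $$G^{4,0}_{0,4}(y\mid 0,0,0,0)=\frac1{2\pi i}\int_{c-i\infty}^{c+i\infty}\Gamma(s)^4\,y^{-s}\,ds\qquad(y>0),$$ where $c>0$ is arbitrary; the integral converges absolutely, and its value is real and nonnegative. -/

import Mathlib

open MeasureTheory ProbabilityTheory
open scoped ENNReal

/-- The integrand of the Mellin-Barnes integral, without the factor `y ^ (-s)`: the quotient of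
`∏_{j ≤ m} Γ(b_j + s) ∏_{j ≤ n} Γ(1 - a_j - s)` by
`∏_{j > n} Γ(a_j + s) ∏_{j > m} Γ(1 - b_j - s)`, where `a` has `p` and `b` has `q` entries. -/
noncomputable def meijerKernel {p q : ℕ} (m n : ℕ) (a : Fin p → ℂ) (b : Fin q → ℂ) (s : ℂ) : ℂ :=
  (∏ j : Fin q, if (j : ℕ) < m then Complex.Gamma (b j + s) else (Complex.Gamma (1 - b j - s))⁻¹) *
    ∏ j : Fin p, if (j : ℕ) < n then Complex.Gamma (1 - a j - s) else (Complex.Gamma (a j + s))⁻¹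

/-- The Meijer G-function `G_{p,q}^{m,n}(y | a ; b)` at `y > 0`, as the Mellin-Barnes integral
`(1 / 2πi) ∫_{c - i∞}^{c + i∞} meijerKernel m n a b s * y ^ (-s) ds` along the line `Re s = c`.
The line has to separate the poles of the `Γ(b_j + s)` (on its left) from those of the
`Γ(1 - a_j - s)` (on its right); when `p = 0` and `b = 0` this means `c > 0`. -/
noncomputable def meijerG {p q : ℕ} (m n : ℕ) (a : Fin p → ℂ) (b : Fin q → ℂ) (c y : ℝ) : ℂ :=
  mellinInv c (meijerKernel m n a b) y

/-- The Meijer G-function `G_{0,4}^{4,0}(y | 0, 0, 0, 0)`, integrated along `Re s = c`. -/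
noncomputable def meijerG₄ (c y : ℝ) : ℂ :=
  meijerG 4 0 (fun j : Fin 0 => j.elim0) (fun _ : Fin 4 => 0) c y

/-- The constant `K = (2π)^(-4/2) ∏_h v_h^(-1/2)`, for variances `v_1, …, v_4`. -/
noncomputable def productNormalConst (v : Fin 4 → ℝ) : ℝ :=
  (2 * Real.pi) ^ (-(4 / 2) : ℝ) * ∏ h, v h ^ (-(1 / 2) : ℝ)

/-- The function `x ↦ K * G_{0,4}^{4,0}(x² ∏_h (2 v_h)⁻¹ | 0, 0, 0, 0)`. -/
noncomputable def productNormalDensity (c : ℝ) (v : Fin 4 → ℝ) (x : ℝ) : ℝ :=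
  productNormalConst v * (meijerG₄ c (x ^ 2 * ∏ h, (2 * v h)⁻¹)).re

/-- The iterated convolution `μ₁ ∗ ⋯ ∗ μ_R` of a list of measures on `ℝ`. -/
noncomputable def measureConvList (L : List (Measure ℝ)) : Measure ℝ :=
  L.foldr Measure.conv (Measure.dirac 0)

/-- The iterated convolution `f₁ ∗ ⋯ ∗ f_R` of a nonempty list of densities on `ℝ`
(the value on the empty list is a dummy). -/
noncomputable def densityConvList : List (ℝ → ℝ≥0∞) → ℝ → ℝ≥0∞
  | [] => 0
  | [f] => f
  | f :: g :: L => lconvolution f (densityConvList (g :: L)) volume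

/-- The Dirichlet distribution with parameters `a_1, …, a_R`: the law of `X / ∑ r, X_r` where the
`X_r` are independent with laws `Gamma(a_r, 1)`. -/
noncomputable def dirichletMeasure {R : ℕ} (a : Fin R → ℝ) : Measure (Fin R → ℝ) :=
  (Measure.pi fun r => gammaMeasure (a r) 1).map fun x r => x r / ∑ s, x s

/-- A family of PARAFAC marginals `β_h^{(r)} ∈ ℝ^{I_h}`, for `h = 1, …, 4` and `r = 1, …, R`. -/
abbrev ParafacMarginals (R : ℕ) (I : Fin 4 → ℕ) : Type :=
  (h : Fin 4) → Fin R → EuclideanSpace ℝ (Fin (I h))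

/-- A family of local scales `w_{h,r,p}`; the diagonal of `W_{h,r}` is `w h r`. -/
abbrev LocalScales (R : ℕ) (I : Fin 4 → ℕ) : Type :=
  (h : Fin 4) → Fin R → Fin (I h) → ℝ

/-- The `r`-th summand `∏_h β_{h,m_h}^{(r)}` of the entry at `m = (m_1, …, m_4)`. -/
noncomputable def parafacSummand {R : ℕ} {I : Fin 4 → ℕ} (m : (h : Fin 4) → Fin (I h))
    (β : ParafacMarginals R I) (r : Fin R) : ℝ :=
  ∏ h, β h r (m h)

/-- The entry at `m` of the tensor `∑_r β_1^{(r)} ∘ β_2^{(r)} ∘ β_3^{(r)} ∘ β_4^{(r)}`. -/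
noncomputable def parafacEntry {R : ℕ} {I : Fin 4 → ℕ} (m : (h : Fin 4) → Fin (I h))
    (β : ParafacMarginals R I) : ℝ :=
  ∑ r, parafacSummand m β r

/-- The hierarchical global-local prior: the random variables `φ`, `τ`, `lam`, `w`, `β` satisfy
`φ ∼ Dir(α, …, α)`, `τ ∼ Ga(aτ, bτ)`, `lam_{h,r} ∼ Ga(al, bl)` (shape and rate),
`w_{h,r,p} | lam ∼ Exp(lam_{h,r}² / 2)` and `β_h^{(r)} | τ, φ, W ∼ N(0, τ φ_r W_{h,r})`, with
independence within each level, and with `φ`, `τ` and the pair `(lam, w)` independent. -/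
structure IsGlobalLocalPrior {Ω : Type*} [MeasurableSpace Ω] (P : Measure Ω)
    [IsProbabilityMeasure P] {R : ℕ} {I : Fin 4 → ℕ} (α aτ bτ al bl : ℝ)
    (φ : Ω → Fin R → ℝ) (τ : Ω → ℝ) (lam : Ω → Fin 4 → Fin R → ℝ)
    (w : Ω → LocalScales R I) (β : Ω → ParafacMarginals R I) : Prop where
  measurable_φ : Measurable φ
  measurable_τ : Measurable τ
  measurable_lam : Measurable lam
  measurable_w : Measurable w
  measurable_β : Measurable β
  law_φ : P.map φ = dirichletMeasure fun _ => α
  law_τ : P.map τ = gammaMeasure aτ bτ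
  law_lam : P.map lam = Measure.pi fun _ => Measure.pi fun _ => gammaMeasure al bl
  indep_φ_τ : IndepFun φ τ P
  indep_global_local : IndepFun (fun ω => (φ ω, τ ω)) (fun ω => (lam ω, w ω)) P
  law_w : ∀ᵐ l ∂(P.map lam), condDistrib w lam P l =
    Measure.pi fun h => Measure.pi fun r => Measure.pi fun _ => expMeasure (l h r ^ 2 / 2)
  law_β : ∀ᵐ θ ∂(P.map fun ω => (τ ω, φ ω, w ω)),
    condDistrib β (fun ω => (τ ω, φ ω, w ω)) P θ =
      Measure.pi fun h => Measure.pi fun r =>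
        multivariateGaussian 0 ((θ.1 * θ.2.1 r) • Matrix.diagonal (θ.2.2 h r))

open Set Filter Topology

/-- The multiplicative convolution `y ↦ ∫_{u > 0} e^{-u} F(y / u) du / u` of `F` with `e^{-u}`. -/
noncomputable def expMulConv (F : ℝ → ℝ) (y : ℝ) : ℝ :=
  ∫ u in Ioi (0 : ℝ), Real.exp (-u) * F (y / u) / u

/-- The `(n+1)`-fold multiplicative convolution of `e^{-u}` with itself. -/
noncomputable def expMulConvPow : ℕ → ℝ → ℝ
  | 0 => fun y => Real.exp (-y)
  | n + 1 => expMulConv (expMulConvPow n)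

/-- `F` is continuous on `(0, ∞)`, with values between `0` and `1 / y`. -/
structure ContinuousInvBounded (F : ℝ → ℝ) : Prop where
  continuousOn : ContinuousOn F (Ioi 0)
  nonneg : ∀ y, 0 < y → 0 ≤ F y
  le_inv : ∀ y, 0 < y → F y ≤ y⁻¹

lemma integrableOn_exp_neg_Ioi_zero : IntegrableOn (fun u : ℝ => Real.exp (-u)) (Ioi 0) := by
  simpa using exp_neg_integrableOn_Ioi 0 one_pos

lemma continuousInvBounded_exp_neg : ContinuousInvBounded fun y => Real.exp (-y) where
  continuousOn := by fun_prop
  nonneg _ _ := (Real.exp_pos _).le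
  le_inv y hy := by
    rw [Real.exp_neg]
    exact inv_anti₀ hy (by linarith [Real.add_one_le_exp y])

namespace ContinuousInvBounded

variable {F : ℝ → ℝ}

lemma integrand_nonneg (hF : ContinuousInvBounded F) {y u : ℝ} (hy : 0 < y) (hu : 0 < u) :
    0 ≤ Real.exp (-u) * F (y / u) / u :=
  div_nonneg (mul_nonneg (Real.exp_pos _).le (hF.nonneg _ (div_pos hy hu))) hu.le

lemma integrand_le (hF : ContinuousInvBounded F) {y u : ℝ} (hy : 0 < y) (hu : 0 < u) :
    Real.exp (-u) * F (y / u) / u ≤ Real.exp (-u) * y⁻¹ := by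
  rw [mul_div_assoc]
  refine mul_le_mul_of_nonneg_left ?_ (Real.exp_pos _).le
  rw [div_le_iff₀ hu]
  exact (hF.le_inv _ (div_pos hy hu)).trans_eq (by field_simp)

lemma continuousOn_integrand (hF : ContinuousInvBounded F) :
    ContinuousOn (fun p : ℝ × ℝ => Real.exp (-p.1) * F (p.2 / p.1) / p.1) (Ioi 0 ×ˢ Ioi 0) := by
  have h : ∀ p ∈ (Ioi 0 ×ˢ Ioi 0 : Set (ℝ × ℝ)), p.1 ≠ 0 := fun p hp => ne_of_gt hp.1
  refine ContinuousOn.div (ContinuousOn.mul (by fun_prop) ?_) (by fun_prop) h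
  exact hF.continuousOn.comp (ContinuousOn.div (by fun_prop) (by fun_prop) h)
    fun p hp => mem_Ioi.2 (div_pos hp.2 hp.1)

lemma aestronglyMeasurable_integrand (hF : ContinuousInvBounded F) {y : ℝ} (hy : 0 < y) :
    AEStronglyMeasurable (fun u => Real.exp (-u) * F (y / u) / u) (volume.restrict (Ioi 0)) := by
  refine ContinuousOn.aestronglyMeasurable ?_ measurableSet_Ioi
  exact hF.continuousOn_integrand.comp (f := fun u : ℝ => (u, y)) (by fun_prop)
    fun u hu => ⟨hu, hy⟩

lemma integrableOn_integrand (hF : ContinuousInvBounded F) {y : ℝ} (hy : 0 < y) :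
    IntegrableOn (fun u => Real.exp (-u) * F (y / u) / u) (Ioi 0) := by
  refine (integrableOn_exp_neg_Ioi_zero.mul_const y⁻¹).mono'
    (hF.aestronglyMeasurable_integrand hy) ?_
  filter_upwards [ae_restrict_mem measurableSet_Ioi] with u hu
  rw [Real.norm_of_nonneg (hF.integrand_nonneg hy hu)]
  exact hF.integrand_le hy hu

lemma expMulConv (hF : ContinuousInvBounded F) : ContinuousInvBounded (expMulConv F) where
  continuousOn := by
    refine continuousOn_of_forall_continuousAt fun y₀ hy₀ => ?_
    have hy₀ : 0 < y₀ := hy₀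
    refine continuousAt_of_dominated (bound := fun u => Real.exp (-u) * (y₀ / 2)⁻¹) ?_ ?_
      (integrableOn_exp_neg_Ioi_zero.mul_const _) ?_
    · filter_upwards [lt_mem_nhds hy₀] with y hy using hF.aestronglyMeasurable_integrand hy
    · filter_upwards [lt_mem_nhds (half_lt_self hy₀)] with y hy
      have hy' : 0 < y := (half_pos hy₀).trans hy
      filter_upwards [ae_restrict_mem measurableSet_Ioi] with u hu
      rw [Real.norm_of_nonneg (hF.integrand_nonneg hy' hu)]
      refine (hF.integrand_le hy' hu).trans
        (mul_le_mul_of_nonneg_left ?_ (Real.exp_pos _).le)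
      exact inv_anti₀ (half_pos hy₀) hy.le
    · filter_upwards [ae_restrict_mem measurableSet_Ioi] with u hu
      have hu : 0 < u := hu
      have : ContinuousAt F (y₀ / u) := hF.continuousOn.continuousAt (Ioi_mem_nhds (div_pos hy₀ hu))
      have : ContinuousAt (fun y => F (y / u)) y₀ :=
        ContinuousAt.comp (f := fun y => y / u) this (by fun_prop)
      fun_prop
  nonneg y hy := setIntegral_nonneg measurableSet_Ioi fun u hu => hF.integrand_nonneg hy hu
  le_inv y hy := by
    refine (setIntegral_mono_on (hF.integrableOn_integrand hy)
      (integrableOn_exp_neg_Ioi_zero.mul_const y⁻¹) measurableSet_Ioi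
      fun u hu => hF.integrand_le hy hu).trans_eq ?_
    rw [integral_mul_const, integral_exp_neg_Ioi_zero, one_mul]

end ContinuousInvBounded

lemma continuousInvBounded_expMulConvPow (n : ℕ) : ContinuousInvBounded (expMulConvPow n) := by
  induction n with
  | zero => exact continuousInvBounded_exp_neg
  | succ n ih => exact ih.expMulConv

lemma integral_rpow_mul_comp_div {F : ℝ → ℝ} {σ u : ℝ} (hu : 0 < u) :
    ∫ y in Ioi (0 : ℝ), y ^ (σ - 1) * F (y / u) = u ^ σ * ∫ y in Ioi (0 : ℝ), y ^ (σ - 1) * F y := by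
  have h : ∀ y ∈ Ioi (0 : ℝ), y ^ (σ - 1) * F (y / u)
      = u ^ (σ - 1) * (fun t => t ^ (σ - 1) * F t) (y * u⁻¹) := fun y hy => by
    have hy : 0 < y := hy
    have : y ^ (σ - 1) = u ^ (σ - 1) * (y * u⁻¹) ^ (σ - 1) := by
      rw [← Real.mul_rpow hu.le (by positivity)]
      congr 1
      field_simp
    simp only [div_eq_mul_inv]
    rw [this]
    ring
  rw [setIntegral_congr_fun measurableSet_Ioi h, integral_const_mul,
    integral_comp_mul_right_Ioi (fun t => t ^ (σ - 1) * F t) _ (inv_pos.2 hu), zero_mul, inv_inv, smul_eq_mul, ← mul_assoc,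
    ← Real.rpow_add_one hu.ne', sub_add_cancel]

/-- The Mellin transform turns the multiplicative convolution with `e^{-u}` into a product
with `Γ`. -/
lemma hasMellin_expMulConv {F : ℝ → ℝ} (hF : ContinuousInvBounded F) {s : ℂ} (hs : 0 < s.re)
    (hconv : MellinConvergent (fun y => (F y : ℂ)) s) :
    HasMellin (fun y => (expMulConv F y : ℂ)) s (Complex.Gamma s * mellin (fun y => (F y : ℂ)) s) := by
  set μ := volume.restrict (Ioi (0 : ℝ)) with hμ
  let G : ℝ × ℝ → ℂ := fun p =>
    (p.2 : ℂ) ^ (s - 1) • ((Real.exp (-p.1) * F (p.2 / p.1) / p.1 : ℝ) : ℂ)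
  have hGm : AEStronglyMeasurable G (μ.prod μ) := by
    rw [hμ, Measure.prod_restrict]
    refine ContinuousOn.aestronglyMeasurable (ContinuousOn.fun_smul ?_ ?_)
      (measurableSet_Ioi.prod measurableSet_Ioi)
    · intro p hp
      refine ContinuousAt.continuousWithinAt ?_
      exact ContinuousAt.cpow (by fun_prop) continuousAt_const (Or.inl hp.2)
    · exact Complex.continuous_ofReal.comp_continuousOn hF.continuousOn_integrand
  have hGu : ∀ u, 0 < u → (fun y : ℝ => G (u, y)) = fun y : ℝ =>
      ((Real.exp (-u) / u : ℝ) : ℂ) * ((y : ℂ) ^ (s - 1) • (fun t => (F t : ℂ)) (u⁻¹ * y)) := by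
    intro u hu
    funext y
    simp only [G, smul_eq_mul]
    rw [inv_mul_eq_div]
    push_cast
    ring
  have hnorm : ∀ u, 0 < u → ∫ y, ‖G (u, y)‖ ∂μ
      = (Real.exp (-u) * u ^ (s.re - 1)) * ∫ y in Ioi (0 : ℝ), y ^ (s.re - 1) * F y := by
    intro u hu
    have : ∀ y ∈ Ioi (0 : ℝ), ‖G (u, y)‖
        = (Real.exp (-u) / u) * (y ^ (s.re - 1) * F (y / u)) := fun y hy => by
      have hy : 0 < y := hy
      simp only [G, norm_smul]
      rw [Complex.norm_real, Real.norm_of_nonneg (hF.integrand_nonneg hy hu),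
        Complex.norm_cpow_eq_rpow_re_of_pos hy, Complex.sub_re, Complex.one_re]
      ring
    rw [setIntegral_congr_fun measurableSet_Ioi this, integral_const_mul,
      integral_rpow_mul_comp_div hu, Real.rpow_sub_one hu.ne']
    ring
  have hGi : Integrable G (μ.prod μ) := by
    rw [integrable_prod_iff hGm]
    constructor
    · filter_upwards [ae_restrict_mem measurableSet_Ioi] with u hu
      rw [hGu u hu]
      exact (((MellinConvergent.comp_mul_left (inv_pos.2 hu)).2 hconv).const_mul _)
    · refine Integrable.congr (f := fun u => (Real.exp (-u) * u ^ (s.re - 1)) *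
        ∫ y in Ioi (0 : ℝ), y ^ (s.re - 1) * F y) ?_ ?_
      · exact (Real.GammaIntegral_convergent hs).mul_const _
      · filter_upwards [ae_restrict_mem measurableSet_Ioi] with u hu using (hnorm u hu).symm
  have hint : ∀ y, ∫ u, G (u, y) ∂μ = (y : ℂ) ^ (s - 1) • ((expMulConv F y : ℝ) : ℂ) := by
    intro y
    simp only [G]
    rw [integral_smul, integral_complex_ofReal]
    rfl
  constructor
  · exact hGi.integral_prod_right.congr (ae_of_all _ hint)
  · calc mellin (fun y => (expMulConv F y : ℂ)) s
        = ∫ y, ∫ u, G (u, y) ∂μ ∂μ := (integral_congr_ae (ae_of_all _ hint)).symm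
      _ = ∫ u, ∫ y, G (u, y) ∂μ ∂μ := (integral_integral_swap (f := fun u y => G (u, y)) hGi).symm
      _ = ∫ u in Ioi (0 : ℝ), ((Real.exp (-u) : ℝ) : ℂ) * (u : ℂ) ^ (s - 1) *
            mellin (fun y => (F y : ℂ)) s := by
          refine setIntegral_congr_fun measurableSet_Ioi fun u hu => ?_
          have hu : 0 < u := hu
          have hu' : (u : ℂ) ≠ 0 := by exact_mod_cast hu.ne'
          have harg : (u : ℂ).arg ≠ Real.pi := by
            rw [Complex.arg_ofReal_of_nonneg hu.le]; exact Real.pi_pos.ne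
          have := mellin_comp_mul_left (fun t => (F t : ℂ)) s (inv_pos.2 hu)
          simp only [mellin] at this ⊢
          simp only [hGu u hu, integral_const_mul]
          rw [this, Complex.ofReal_inv, Complex.inv_cpow _ _ harg, Complex.cpow_neg, inv_inv,
            Complex.cpow_sub _ _ hu', Complex.cpow_one, smul_eq_mul]
          push_cast
          ring
      _ = _ := by
          rw [integral_mul_const, Complex.Gamma_eq_integral hs]
          rfl

lemma hasMellin_expMulConvPow (n : ℕ) {s : ℂ} (hs : 0 < s.re) :
    HasMellin (fun y => (expMulConvPow n y : ℂ)) s (Complex.Gamma s ^ (n + 1)) := by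
  induction n with
  | zero =>
    have h : ∀ y : ℝ, (y : ℂ) ^ (s - 1) • ((expMulConvPow 0 y : ℝ) : ℂ)
        = ((Real.exp (-y) : ℝ) : ℂ) * (y : ℂ) ^ (s - 1) := fun y => by
      rw [smul_eq_mul, mul_comm]; rfl
    constructor
    · exact (Complex.GammaIntegral_convergent hs).congr_fun (fun y _ => (h y).symm)
        measurableSet_Ioi
    · rw [zero_add, pow_one, Complex.Gamma_eq_integral hs]
      exact integral_congr_ae (ae_of_all _ h)
  | succ n ih =>
    have := hasMellin_expMulConv (continuousInvBounded_expMulConvPow n) hs ih.1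
    rwa [ih.2, ← pow_succ'] at this

lemma norm_Gamma_le_Gamma_re {s : ℂ} (hs : 0 < s.re) : ‖Complex.Gamma s‖ ≤ Real.Gamma s.re := by
  rw [Complex.Gamma_eq_integral hs, Real.Gamma_eq_integral hs]
  refine (norm_integral_le_integral_norm _).trans_eq ?_
  refine setIntegral_congr_fun measurableSet_Ioi fun u hu => ?_
  simp only [norm_mul, Complex.norm_real, Real.norm_eq_abs, abs_of_pos (Real.exp_pos _),
    Complex.norm_cpow_eq_rpow_re_of_pos hu, Complex.sub_re, Complex.one_re]

lemma norm_Gamma_le_div_norm {s : ℂ} (hs : 0 < s.re) :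
    ‖Complex.Gamma s‖ ≤ Real.Gamma (s.re + 1) / ‖s‖ := by
  have h0 : s ≠ 0 := by rintro rfl; simp at hs
  rw [le_div_iff₀ (norm_pos_iff.2 h0), mul_comm, ← norm_mul, ← Complex.Gamma_add_one s h0]
  simpa using norm_Gamma_le_Gamma_re (s := s + 1) (by simpa using hs.trans (lt_add_one _))

lemma verticalIntegrable_Gamma_pow {n : ℕ} (hn : 2 ≤ n) {c : ℝ} (hc : 0 < c) :
    Complex.VerticalIntegrable (fun s => Complex.Gamma s ^ n) c := by
  have hre : ∀ y : ℝ, ((c : ℂ) + y * Complex.I).re = c := fun y => by simp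
  have hcont : Continuous fun y : ℝ => Complex.Gamma ((c : ℂ) + y * Complex.I) := by
    refine continuous_iff_continuousAt.2 fun y => ?_
    refine ContinuousAt.comp (f := fun y : ℝ => (c : ℂ) + y * Complex.I) ?_ (by fun_prop)
    refine (Complex.differentiableAt_Gamma _ fun m hm => ?_).continuousAt
    have := congrArg Complex.re hm
    rw [hre] at this
    simp at this
    linarith [(Nat.cast_nonneg m : (0 : ℝ) ≤ m)]
  set k := min (c ^ 2) 1 with hk
  have hk0 : 0 < k := lt_min (by positivity) one_pos
  set A := Real.Gamma c with hA
  have hA0 : 0 < A := Real.Gamma_pos_of_pos hc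
  set B := Real.Gamma (c + 1)
  refine Integrable.mono' (g := fun y : ℝ => A ^ (n - 2) * (B ^ 2 / k) * (1 + y ^ 2)⁻¹)
    (integrable_inv_one_add_sq.const_mul _) (hcont.pow n).aestronglyMeasurable
    (ae_of_all _ fun y => ?_)
  have h1 := norm_Gamma_le_Gamma_re (s := (c : ℂ) + y * Complex.I) (by rwa [hre])
  have h2 := norm_Gamma_le_div_norm (s := (c : ℂ) + y * Complex.I) (by rwa [hre])
  rw [hre] at h1 h2
  have hns : ‖(c : ℂ) + y * Complex.I‖ ^ 2 = c ^ 2 + y ^ 2 := by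
    rw [Complex.sq_norm, Complex.normSq_add_mul_I]
  have h3 : ‖Complex.Gamma ((c : ℂ) + y * Complex.I)‖ ^ 2 ≤ B ^ 2 / k * (1 + y ^ 2)⁻¹ := by
    refine (pow_le_pow_left₀ (norm_nonneg _) h2 2).trans ?_
    rw [div_pow, hns, ← div_eq_mul_inv, div_div]
    refine div_le_div_of_nonneg_left (sq_nonneg _) (by positivity) ?_
    have : k ≤ c ^ 2 := min_le_left _ _
    have : k ≤ 1 := min_le_right _ _
    nlinarith [sq_nonneg y]
  rw [norm_pow, ← Nat.sub_add_cancel hn, pow_add, mul_assoc, Nat.add_sub_cancel]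
  exact mul_le_mul (pow_le_pow_left₀ (norm_nonneg _) h1 _) h3 (by positivity) (by positivity)

lemma meijerKernel_four_zero (s : ℂ) :
    meijerKernel 4 0 (fun j : Fin 0 => j.elim0) (fun _ : Fin 4 => 0) s = Complex.Gamma s ^ 4 := by
  simp [meijerKernel]

lemma meijerG₄_eq {c y : ℝ} (hc : 0 < c) (hy : 0 < y) :
    meijerG₄ c y = (expMulConvPow 3 y : ℂ) := by
  have hM : ∀ t : ℝ, mellin (fun y => (expMulConvPow 3 y : ℂ)) ((c : ℂ) + t * Complex.I)
      = Complex.Gamma ((c : ℂ) + t * Complex.I) ^ 4 :=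
    fun t => (hasMellin_expMulConvPow 3 (by simpa using hc)).2
  have hcont : ContinuousAt (fun y => (expMulConvPow 3 y : ℂ)) y :=
    Complex.continuous_ofReal.continuousAt.comp
      ((continuousInvBounded_expMulConvPow 3).continuousOn.continuousAt (Ioi_mem_nhds hy))
  rw [← mellinInv_mellin_eq c _ hy (hasMellin_expMulConvPow 3 (by simpa using hc)).1 ?_ hcont]
  · simp only [meijerG₄, meijerG, mellinInv, meijerKernel_four_zero, hM]
  · have := verticalIntegrable_Gamma_pow (n := 4) (by norm_num) hc
    simpa only [Complex.VerticalIntegrable, hM] using this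

lemma verticalIntegrable_cpow_mul_meijerKernel {c y : ℝ} (hc : 0 < c) (hy : 0 < y) :
    Complex.VerticalIntegrable (fun s => (y : ℂ) ^ (-s) *
      meijerKernel 4 0 (fun j : Fin 0 => j.elim0) (fun _ : Fin 4 => 0) s) c := by
  simp only [meijerKernel_four_zero]
  refine Integrable.bdd_mul (c := y ^ (-c))
    (verticalIntegrable_Gamma_pow (n := 4) (by norm_num) hc) ?_ (ae_of_all _ fun t => ?_)
  · refine Continuous.aestronglyMeasurable ?_
    refine Continuous.const_cpow (by fun_prop) (Or.inl ?_)
    exact_mod_cast hy.ne'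
  · rw [Complex.norm_cpow_eq_rpow_re_of_pos hy]
    simp

lemma measurable_expMulConvPow (n : ℕ) : Measurable (expMulConvPow n) := by
  induction n with
  | zero => exact Real.measurable_exp.comp measurable_neg
  | succ n ih =>
    have : Measurable fun p : ℝ × ℝ => Real.exp (-p.2) * expMulConvPow n (p.1 / p.2) / p.2 := by
      fun_prop
    exact (this.stronglyMeasurable.integral_prod_right
      (ν := volume.restrict (Ioi 0))).measurable

lemma lintegral_eq_two_mul_setLIntegral_Ioi {H : ℝ → ℝ≥0∞} (hH : ∀ x, H (-x) = H x) :
    ∫⁻ x, H x = 2 * ∫⁻ x in Ioi (0 : ℝ), H x := by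
  have hneg : ∫⁻ x in Iio (0 : ℝ), H x = ∫⁻ x in Ioi (0 : ℝ), H x := by
    have him : (fun x : ℝ => -x) '' Ioi 0 = Iio 0 := by simp
    rw [← him, lintegral_image_eq_lintegral_abs_deriv_mul measurableSet_Ioi
      (fun x _ => (hasDerivAt_neg x).hasDerivWithinAt) neg_injective.injOn]
    simp [hH]
  rw [← lintegral_add_compl H measurableSet_Ioi, compl_Ioi,
    setLIntegral_congr Iio_ae_eq_Iic.symm, hneg, two_mul]

lemma lintegral_comp_mul_left_eq {a : ℝ} (ha : a ≠ 0) {h : ℝ → ℝ≥0∞} (hh : Measurable h) :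
    ∫⁻ x, h (a * x) = ENNReal.ofReal |a⁻¹| * ∫⁻ x, h x := by
  rw [← lintegral_map hh (measurable_const_mul a), Real.map_volume_mul_left ha,
    lintegral_smul_measure, smul_eq_mul]

lemma lintegral_exp_mul_comp_sq {F : ℝ → ℝ} (hF : ContinuousInvBounded F)
    {v b t : ℝ} (hv : 0 < v) (hb : 0 < b) (ht : t ≠ 0) :
    ∫⁻ z : ℝ, ENNReal.ofReal (Real.exp (-(z ^ 2 / (2 * v))) * |z⁻¹| * F ((z⁻¹ * t) ^ 2 * b)) =
      ENNReal.ofReal (expMulConv F (t ^ 2 * ((2 * v)⁻¹ * b))) := by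
  set y := t ^ 2 * ((2 * v)⁻¹ * b) with hy
  have hy0 : 0 < y := by positivity
  have him : (fun z : ℝ => z ^ 2 / (2 * v)) '' Ioi 0 = Ioi 0 := by
    ext u
    constructor
    · rintro ⟨z, hz, rfl⟩
      have hz : 0 < z := hz
      exact mem_Ioi.2 (by positivity)
    · intro hu
      have hu : 0 < u := hu
      refine ⟨√(2 * v * u), mem_Ioi.2 (by positivity), ?_⟩
      simp only
      rw [Real.sq_sqrt (by positivity)]
      field_simp
  have hinj : InjOn (fun z : ℝ => z ^ 2 / (2 * v)) (Ioi 0) := by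
    intro a ha b hb hab
    have hab : a ^ 2 / (2 * v) = b ^ 2 / (2 * v) := hab
    rw [div_left_inj' (by positivity)] at hab
    exact (pow_left_inj₀ (le_of_lt ha) (le_of_lt hb) two_ne_zero).1 hab
  have hder : ∀ z ∈ Ioi (0 : ℝ),
      HasDerivWithinAt (fun z : ℝ => z ^ 2 / (2 * v)) (z / v) (Ioi 0) z := fun z _ => by
    refine (((hasDerivAt_pow 2 z).div_const (2 * v)).congr_deriv ?_).hasDerivWithinAt
    push_cast
    field_simp
  rw [expMulConv, ofReal_integral_eq_lintegral_ofReal (hF.integrableOn_integrand hy0)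
    (by filter_upwards [ae_restrict_mem measurableSet_Ioi] with u hu
        using hF.integrand_nonneg hy0 hu),
    lintegral_eq_two_mul_setLIntegral_Ioi (by simp), ← lintegral_const_mul' _ _ (by simp)]
  nth_rw 2 [← him]
  rw [lintegral_image_eq_lintegral_abs_deriv_mul measurableSet_Ioi hder hinj]
  refine setLIntegral_congr_fun measurableSet_Ioi fun z hz => ?_
  have hz : 0 < z := hz
  rw [← ENNReal.ofReal_mul (abs_nonneg _), abs_of_pos (inv_pos.2 hz), abs_of_pos (div_pos hz hv),
    show (2 : ℝ≥0∞) = ENNReal.ofReal 2 by simp, ← ENNReal.ofReal_mul zero_le_two,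
    show y / (z ^ 2 / (2 * v)) = (z⁻¹ * t) ^ 2 * b by rw [hy]; field_simp]
  congr 1
  field_simp

lemma gaussianReal_toNNReal_eq_withDensity {v : ℝ} (hv : 0 < v) :
    gaussianReal 0 v.toNNReal = volume.withDensity fun x =>
      ENNReal.ofReal ((√(2 * Real.pi * v))⁻¹ * Real.exp (-(x ^ 2 / (2 * v)))) := by
  rw [gaussianReal_of_var_ne_zero _ (by simpa using hv)]
  congr 1
  funext x
  simp [gaussianPDF, gaussianPDFReal, hv.le, neg_div]

/-- The density of the product of a centred Gaussian variable with an independent variable whose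
density is a function of the square. -/
lemma gaussianReal_mconv_withDensity {F : ℝ → ℝ} (hF : ContinuousInvBounded F) (hFm : Measurable F)
    {v b k : ℝ} (hv : 0 < v) (hb : 0 < b) (hk : 0 ≤ k) :
    (gaussianReal 0 v.toNNReal).mconv
        (volume.withDensity fun x => ENNReal.ofReal (k * F (x ^ 2 * b))) =
      volume.withDensity fun x => ENNReal.ofReal
        ((√(2 * Real.pi * v))⁻¹ * k * expMulConv F (x ^ 2 * ((2 * v)⁻¹ * b))) := by
  set c₀ := (√(2 * Real.pi * v))⁻¹
  have hc₀ : 0 ≤ c₀ := by positivity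
  refine Measure.ext_of_lintegral _ fun g hg => ?_
  have hp : Measurable fun x => ENNReal.ofReal (k * F (x ^ 2 * b)) := by fun_prop
  have hφ : Measurable fun z : ℝ => ENNReal.ofReal (c₀ * Real.exp (-(z ^ 2 / (2 * v)))) := by
    fun_prop
  have hD : AEMeasurable fun x => ENNReal.ofReal
      (c₀ * k * expMulConv F (x ^ 2 * ((2 * v)⁻¹ * b))) := by
    have : Measurable fun p : ℝ × ℝ => Real.exp (-p.2) * F (p.1 / p.2) / p.2 := by fun_prop
    have : Measurable (expMulConv F) := (this.stronglyMeasurable.integral_prod_right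
      (ν := volume.restrict (Ioi 0))).measurable
    fun_prop
  rw [lintegral_withDensity_eq_lintegral_mul₀ hD hg.aemeasurable,
    Measure.lintegral_mconv hg, gaussianReal_toNNReal_eq_withDensity hv,
    lintegral_withDensity_eq_lintegral_mul _ hφ
      (Measurable.lintegral_prod_right' (f := fun p : ℝ × ℝ => g (p.1 * p.2)) (by fun_prop))]
  have hne : ∀ᵐ z : ℝ, z ≠ 0 := by simp [ae_iff]
  calc _ = ∫⁻ z : ℝ, ∫⁻ t : ℝ, ENNReal.ofReal (c₀ * Real.exp (-(z ^ 2 / (2 * v)))) *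
          (ENNReal.ofReal |z⁻¹| * (ENNReal.ofReal (k * F ((z⁻¹ * t) ^ 2 * b)) * g t)) := by
        refine lintegral_congr_ae ?_
        filter_upwards [hne] with z hz
        have h1 : Measurable fun t => ENNReal.ofReal (k * F ((z⁻¹ * t) ^ 2 * b)) * g t := by
          fun_prop
        have h2 := lintegral_comp_mul_left_eq hz h1
        rw [lintegral_const_mul _ (h1.const_mul _), lintegral_const_mul _ h1, ← h2, Pi.mul_apply,
          lintegral_withDensity_eq_lintegral_mul _ hp (by fun_prop)]
        simp [hz]
    _ = ∫⁻ t : ℝ, ∫⁻ z : ℝ, ENNReal.ofReal (c₀ * Real.exp (-(z ^ 2 / (2 * v)))) *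
          (ENNReal.ofReal |z⁻¹| * (ENNReal.ofReal (k * F ((z⁻¹ * t) ^ 2 * b)) * g t)) :=
        lintegral_lintegral_swap (by fun_prop)
    _ = _ := by
        refine lintegral_congr_ae ?_
        filter_upwards [hne] with t ht
        rw [Pi.mul_apply, mul_assoc c₀ k, ENNReal.ofReal_mul hc₀, ENNReal.ofReal_mul hk,
          ← lintegral_exp_mul_comp_sq hF hv hb ht, ← mul_assoc,
          ← ENNReal.ofReal_mul hc₀, ← lintegral_const_mul' _ _ (by simp),
          ← lintegral_mul_const _ (by fun_prop)]
        refine lintegral_congr fun z => ?_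
        rw [← mul_assoc, ← mul_assoc, ← ENNReal.ofReal_mul (by positivity),
          ← ENNReal.ofReal_mul (by positivity), ← ENNReal.ofReal_mul (by positivity)]
        congr 2
        ring

/-- The law of the product of `n + 1` independent variables as a multiplicative convolution. -/
@[to_additive]
lemma map_prod_pi_succ {M : Type*} [CommMonoid M] [MeasurableSpace M] [MeasurableMul₂ M] {n : ℕ}
    (μ : Fin (n + 1) → Measure M) [∀ i, SigmaFinite (μ i)] :
    (Measure.pi μ).map (fun x => ∏ i, x i) =
      (μ 0).mconv ((Measure.pi fun i : Fin n => μ i.succ).map fun x => ∏ i, x i) := by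
  have hmp := measurePreserving_piFinSuccAbove μ 0
  have hm : Measurable fun x : Fin n → M => ∏ i, x i :=
    Finset.measurable_prod _ fun i _ => measurable_pi_apply i
  have h1 : (fun x : Fin (n + 1) → M => ∏ i, x i) =
      (fun p : M × (Fin n → M) => p.1 * ∏ i, p.2 i) ∘
        MeasurableEquiv.piFinSuccAbove (fun _ => M) 0 := by
    funext x
    simp [Fin.prod_univ_succ, Fin.tail]
  have h2 : (fun p : M × (Fin n → M) => p.1 * ∏ i, p.2 i) =
      (fun q : M × M => q.1 * q.2) ∘ Prod.map id (fun x : Fin n → M => ∏ i, x i) := rfl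
  have h3 := Measure.map_prod_map (μ 0) (Measure.pi fun i : Fin n => μ i.succ)
    measurable_id hm
  have h4 : Measurable fun p : M × (Fin n → M) => p.1 * ∏ i, p.2 i :=
    measurable_fst.mul (hm.comp measurable_snd)
  rw [Measure.map_id] at h3
  rw [Measure.mconv, h3, Measure.map_map measurable_mul (measurable_id.prodMap hm), ← h2, h1,
    ← Measure.map_map h4 hmp.measurable, hmp.map_eq]
  simp

/-- The density of a product of independent centred Gaussian variables. -/
lemma map_prod_pi_gaussianReal {n : ℕ} (v : Fin (n + 1) → ℝ) (hv : ∀ i, 0 < v i) :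
    (Measure.pi fun i => gaussianReal 0 (v i).toNNReal).map (fun x => ∏ i, x i) =
      volume.withDensity fun x => ENNReal.ofReal
        ((∏ i, (√(2 * Real.pi * v i))⁻¹) * expMulConvPow n (x ^ 2 * ∏ i, (2 * v i)⁻¹)) := by
  induction n with
  | zero =>
    rw [map_prod_pi_succ]
    have : (Measure.pi fun i : Fin 0 => gaussianReal 0 (v i.succ).toNNReal).map
        (fun x => ∏ i, x i) = Measure.dirac 1 := by
      rw [Measure.pi_of_empty _ finZeroElim, Measure.map_dirac' (by fun_prop)]
      simp
    rw [this, Measure.mconv_dirac_one, gaussianReal_toNNReal_eq_withDensity (hv 0)]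
    simp [expMulConvPow, div_eq_mul_inv]
  | succ n ih =>
    rw [map_prod_pi_succ, ih (fun i => v i.succ) fun i => hv _,
      gaussianReal_mconv_withDensity (continuousInvBounded_expMulConvPow n)
        (measurable_expMulConvPow n) (hv 0) (Finset.prod_pos fun i _ => ?_)
        (Finset.prod_nonneg fun i _ => ?_)]
    · simp only [Fin.prod_univ_succ (n := n + 1)]
      rfl
    · have := hv i.succ
      positivity
    · positivity

lemma productNormalDensity_eq {c : ℝ} (hc : 0 < c) {v : Fin 4 → ℝ} (hv : ∀ i, 0 < v i) {x : ℝ}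
    (hx : x ≠ 0) :
    productNormalDensity c v x =
      (∏ i, (√(2 * Real.pi * v i))⁻¹) * expMulConvPow 3 (x ^ 2 * ∏ i, (2 * v i)⁻¹) := by
  have hy : 0 < x ^ 2 * ∏ h, (2 * v h)⁻¹ :=
    mul_pos (by positivity) (Finset.prod_pos fun i _ => by have := hv i; positivity)
  rw [productNormalDensity, meijerG₄_eq hc hy, Complex.ofReal_re]
  congr 1
  have h : ∀ i, (√(2 * Real.pi * v i))⁻¹ = (√(2 * Real.pi))⁻¹ * v i ^ (-(1 / 2) : ℝ) := fun i => by
    rw [Real.sqrt_mul (by positivity), mul_inv, Real.rpow_neg (hv i).le, Real.sqrt_eq_rpow (v i)]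
  simp only [productNormalConst, h, Finset.prod_mul_distrib]
  congr 1
  rw [Finset.prod_const, Finset.card_univ, Fintype.card_fin, inv_pow,
    show √(2 * Real.pi) ^ 4 = (√(2 * Real.pi) ^ 2) ^ 2 by ring, Real.sq_sqrt (by positivity),
    show (-(4 / 2) : ℝ) = -((2 : ℕ) : ℝ) by norm_num, Real.rpow_neg (by positivity),
    Real.rpow_natCast]

lemma ofReal_productNormalDensity_ae_eq {c : ℝ} (hc : 0 < c) {v : Fin 4 → ℝ}
    (hv : ∀ i, 0 < v i) :
    (fun x => ENNReal.ofReal (productNormalDensity c v x)) =ᵐ[volume] fun x => ENNReal.ofReal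
      ((∏ i, (√(2 * Real.pi * v i))⁻¹) * expMulConvPow 3 (x ^ 2 * ∏ i, (2 * v i)⁻¹)) := by
  have hne : ∀ᵐ z : ℝ, z ≠ 0 := by simp [ae_iff]
  filter_upwards [hne] with x hx
  rw [productNormalDensity_eq hc hv hx]

lemma aemeasurable_ofReal_productNormalDensity {c : ℝ} (hc : 0 < c) {v : Fin 4 → ℝ}
    (hv : ∀ i, 0 < v i) :
    AEMeasurable fun x => ENNReal.ofReal (productNormalDensity c v x) := by
  refine AEMeasurable.congr ?_ (ofReal_productNormalDensity_ae_eq hc hv).symm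
  have := measurable_expMulConvPow 3
  fun_prop

/-- `productNormalDensity` is the density of a product of four independent centred Gaussian
variables. -/
lemma map_prod_pi_gaussianReal_four {c : ℝ} (hc : 0 < c) {v : Fin 4 → ℝ} (hv : ∀ i, 0 < v i) :
    (Measure.pi fun i => gaussianReal 0 (v i).toNNReal).map (fun x => ∏ i, x i) =
      volume.withDensity fun x => ENNReal.ofReal (productNormalDensity c v x) := by
  rw [map_prod_pi_gaussianReal v hv,
    withDensity_congr_ae (ofReal_productNormalDensity_ae_eq hc hv)]

lemma map_sum_pi_eq_measureConvList {n : ℕ} (μ : Fin n → Measure ℝ) [∀ i, SigmaFinite (μ i)] :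
    (Measure.pi μ).map (fun x => ∑ i, x i) = measureConvList (List.ofFn μ) := by
  induction n with
  | zero =>
    rw [Measure.pi_of_empty _ finZeroElim, Measure.map_dirac' (by fun_prop)]
    simp [measureConvList]
  | succ n ih =>
    rw [map_sum_pi_succ, ih, List.ofFn_succ]
    rfl

lemma aemeasurable_densityConvList {L : List (ℝ → ℝ≥0∞)} (hL : ∀ f ∈ L, AEMeasurable f) :
    AEMeasurable (densityConvList L) := by
  induction L with
  | nil => exact aemeasurable_const
  | cons f L ih =>
    cases L with
    | nil => exact hL f (by simp)
    | cons g L =>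
      exact aemeasurable_lconvolution (hL f (by simp)) (ih fun k hk => hL k (List.mem_cons_of_mem _ hk))

lemma measureConvList_map_withDensity {L : List (ℝ → ℝ≥0∞)} (hL : ∀ f ∈ L, AEMeasurable f)
    (hne : L ≠ []) :
    measureConvList (L.map volume.withDensity) = volume.withDensity (densityConvList L) := by
  induction L with
  | nil => exact absurd rfl hne
  | cons f L ih =>
    cases L with
    | nil => simp [measureConvList, densityConvList]
    | cons g L =>
      have hL' : ∀ k ∈ g :: L, AEMeasurable k := fun k hk => hL k (List.mem_cons_of_mem _ hk)
      have := ih hL' (by simp)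
      rw [List.map_cons, measureConvList, List.foldr_cons, ← measureConvList, this,
        conv_withDensity_eq_mlconvolution₀ (hL f (by simp)) (aemeasurable_densityConvList hL')]
      rfl

lemma MeasureTheory.Measure.ae_pi_of_forall_ae {ι : Type*} [Fintype ι] {X : ι → Type*}
    [∀ i, MeasurableSpace (X i)] {μ : ∀ i, Measure (X i)} [∀ i, SigmaFinite (μ i)]
    {p : ∀ i, X i → Prop} (h : ∀ i, ∀ᵐ x ∂μ i, p i x) :
    ∀ᵐ x ∂Measure.pi μ, ∀ i, p i (x i) :=
  eventually_all.2 fun i => Measure.tendsto_eval_ae_ae.eventually (h i)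

section Swap

variable {ι κ : Type*} [Fintype ι] [Fintype κ] {X : Type*} [MeasurableSpace X]
  (μ : ι → κ → Measure X) [∀ i j, IsProbabilityMeasure (μ i j)]

lemma MeasureTheory.Measure.map_uncurry_pi_pi :
    (Measure.pi fun i => Measure.pi fun j => μ i j).map (fun x (p : ι × κ) => x p.1 p.2) =
      Measure.pi fun p : ι × κ => μ p.1 p.2 := by
  refine (Measure.pi_eq fun s hs => ?_).symm
  have hpre : (fun (x : ι → κ → X) (p : ι × κ) => x p.1 p.2) ⁻¹' univ.pi s =
      univ.pi fun i => univ.pi fun j => s (i, j) := by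
    ext x
    simp
  rw [Measure.map_apply (by fun_prop) (MeasurableSet.univ_pi hs), hpre, Measure.pi_pi,
    Fintype.prod_prod_type]
  simp only [Measure.pi_pi]

lemma MeasureTheory.Measure.map_uncurry_swap_pi_pi :
    (Measure.pi fun i => Measure.pi fun j => μ i j).map (fun x (p : κ × ι) => x p.2 p.1) =
      Measure.pi fun p : κ × ι => μ p.2 p.1 := by
  refine (Measure.pi_eq fun s hs => ?_).symm
  have hpre : (fun (x : ι → κ → X) (p : κ × ι) => x p.2 p.1) ⁻¹' univ.pi s =
      univ.pi fun i => univ.pi fun j => s (j, i) := by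
    ext x
    simp only [mem_preimage, mem_univ_pi, Prod.forall]
    exact forall_comm
  rw [Measure.map_apply (by fun_prop) (MeasurableSet.univ_pi hs), hpre, Measure.pi_pi,
    Fintype.prod_prod_type_right]
  simp only [Measure.pi_pi]

lemma MeasureTheory.Measure.map_swap_pi_pi :
    (Measure.pi fun i => Measure.pi fun j => μ i j).map (fun x j i => x i j) =
      Measure.pi fun j => Measure.pi fun i => μ i j := by
  have h := (Measure.map_uncurry_swap_pi_pi μ).trans
    (Measure.map_uncurry_pi_pi fun j i => μ i j).symm
  have h' := congrArg (Measure.map fun (y : κ × ι → X) j i => y (j, i)) h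
  rw [Measure.map_map (by fun_prop) (by fun_prop),
    Measure.map_map (by fun_prop) (by fun_prop)] at h'
  exact h'.trans Measure.map_id

end Swap

lemma ae_gammaMeasure_pos (a r : ℝ) : ∀ᵐ x ∂gammaMeasure a r, 0 < x := by
  have h : gammaMeasure a r (Iic 0) = 0 := by
    rw [gammaMeasure, withDensity_apply _ measurableSet_Iic, ← setLIntegral_congr Iio_ae_eq_Iic]
    exact lintegral_gammaPDF_of_nonpos le_rfl
  rw [ae_iff]
  simpa only [not_lt] using! h

lemma ae_dirichletMeasure_pos {R : ℕ} {a : Fin R → ℝ} (ha : ∀ r, 0 < a r) :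
    ∀ᵐ x ∂dirichletMeasure a, ∀ r, 0 < x r := by
  have := fun r => isProbabilityMeasure_gammaMeasure (ha r) one_pos
  have hs : MeasurableSet {x : Fin R → ℝ | ∀ r, 0 < x r} := by
    simp only [ofPred_forall]
    exact .iInter fun r => measurableSet_lt measurable_const (measurable_pi_apply r)
  rw [dirichletMeasure, ae_map_iff (by fun_prop) hs]
  filter_upwards [Measure.ae_pi_of_forall_ae fun r => ae_gammaMeasure_pos (a r) 1] with x hx r
  exact div_pos (hx r) (Finset.sum_pos (fun s _ => hx s) ⟨r, Finset.mem_univ r⟩)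

section Parafac

variable {R : ℕ} {I : Fin 4 → ℕ} (m : (h : Fin 4) → Fin (I h))

lemma measurable_parafacSummand (r : Fin R) :
    Measurable fun β : ParafacMarginals R I => parafacSummand m β r := by
  unfold parafacSummand
  fun_prop

/-- The joint law of the summands of an entry, for independent marginals with centred Gaussian
coordinates. -/
lemma map_parafacSummand_pi_pi {c : ℝ} (hc : 0 < c)
    (μ : (h : Fin 4) → Fin R → Measure (EuclideanSpace ℝ (Fin (I h))))
    [∀ h r, IsProbabilityMeasure (μ h r)] {v : Fin 4 → Fin R → ℝ} (hv : ∀ h r, 0 < v h r)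
    (hμ : ∀ h r, (μ h r).map (fun x => x (m h)) = gaussianReal 0 (v h r).toNNReal) :
    (Measure.pi fun h => Measure.pi fun r => μ h r).map (parafacSummand m) =
      Measure.pi fun r => volume.withDensity fun x =>
        ENNReal.ofReal (productNormalDensity c (fun h => v h r) x) := by
  have hcoord : (Measure.pi fun h => Measure.pi fun r => μ h r).map
      (fun β h r => β h r (m h)) =
      Measure.pi fun h => Measure.pi fun r => gaussianReal 0 (v h r).toNNReal := by
    have h1 : ∀ h, (Measure.pi fun r => μ h r).map (fun x r => x r (m h)) =
        Measure.pi fun r => gaussianReal 0 (v h r).toNNReal := fun h => by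
      have : ∀ r, IsProbabilityMeasure ((μ h r).map (fun x => x (m h))) := fun r => by
        rw [hμ]; infer_instance
      refine (Measure.pi_map_pi (μ := fun r => μ h r)
        (f := fun _ (x : EuclideanSpace ℝ (Fin (I h))) => x (m h)) fun r => by fun_prop).trans ?_
      simp only [hμ]
    have : ∀ h, IsProbabilityMeasure ((Measure.pi fun r => μ h r).map (fun x r => x r (m h))) :=
      fun h => by rw [h1]; infer_instance
    refine (Measure.pi_map_pi (μ := fun h => Measure.pi fun r => μ h r)
      (f := fun h (x : Fin R → EuclideanSpace ℝ (Fin (I h))) r => x r (m h))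
      fun h => (measurable_pi_lambda _ fun r => (by fun_prop : Measurable
        fun y : EuclideanSpace ℝ (Fin (I h)) => y (m h)).comp
          (measurable_pi_apply r)).aemeasurable).trans ?_
    simp only [h1]
  have hprod := fun r => map_prod_pi_gaussianReal_four hc fun h => hv h r
  have hprob : ∀ r, IsProbabilityMeasure
      ((Measure.pi fun h => gaussianReal 0 (v h r).toNNReal).map (fun x => ∏ h, x h)) :=
    fun r => Measure.isProbabilityMeasure_map (by fun_prop)
  have hcomp : (parafacSummand m : ParafacMarginals R I → Fin R → ℝ) =
      (fun (y : Fin R → Fin 4 → ℝ) r => ∏ h, y r h) ∘ (fun x r h => x h r) ∘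
        fun β h r => β h r (m h) := rfl
  rw [hcomp, ← Measure.map_map (by fun_prop) (by fun_prop),
    ← Measure.map_map (by fun_prop) (by fun_prop), hcoord,
    Measure.map_swap_pi_pi fun h r => gaussianReal 0 (v h r).toNNReal]
  refine (Measure.pi_map_pi (f := fun _ (y : Fin 4 → ℝ) => ∏ h, y h) fun r => by fun_prop).trans ?_
  simp only [hprod]

lemma map_multivariateGaussian_smul_diagonal {n : ℕ} {t : ℝ} (ht : 0 ≤ t) {w : Fin n → ℝ}
    (hw : ∀ i, 0 ≤ w i) (i : Fin n) :
    (multivariateGaussian 0 (t • Matrix.diagonal w)).map (fun x => x i) =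
      gaussianReal 0 (t * w i).toNNReal := by
  have hS : (t • Matrix.diagonal w).PosSemidef := (Matrix.PosSemidef.diagonal hw).smul ht
  simpa using (measurePreserving_eval_multivariateGaussian (μ := 0) hS (i := i)).map_eq

end Parafac

lemma IsGlobalLocalPrior.ae_pos {Ω : Type*} [MeasurableSpace Ω] {P : Measure Ω}
    [IsProbabilityMeasure P] {R : ℕ} {I : Fin 4 → ℕ} {α aτ bτ al bl : ℝ}
    (hα : 0 < α) (hal : 0 < al) (hbl : 0 < bl)
    {φ : Ω → Fin R → ℝ} {τ : Ω → ℝ} {lam : Ω → Fin 4 → Fin R → ℝ}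
    {w : Ω → LocalScales R I} {β : Ω → ParafacMarginals R I}
    (hprior : IsGlobalLocalPrior P α aτ bτ al bl φ τ lam w β) :
    ∀ᵐ θ ∂(P.map fun ω => (τ ω, φ ω, w ω)),
      0 < θ.1 ∧ (∀ r, 0 < θ.2.1 r) ∧ ∀ h r p, 0 < θ.2.2 h r p := by
  have hmτ := hprior.measurable_τ
  have hmφ := hprior.measurable_φ
  have hmw := hprior.measurable_w
  have hml := hprior.measurable_lam
  have hw_meas : MeasurableSet {x : LocalScales R I | ∀ h r p, 0 < x h r p} := by
    simp only [ofPred_forall]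
    exact .iInter fun h => .iInter fun r => .iInter fun p =>
      measurableSet_lt measurable_const (by fun_prop)
  have hφ_meas : MeasurableSet {x : Fin R → ℝ | ∀ r, 0 < x r} := by
    simp only [ofPred_forall]
    exact .iInter fun r => measurableSet_lt measurable_const (measurable_pi_apply r)
  have hτ : ∀ᵐ ω ∂P, 0 < τ ω := by
    have := ae_gammaMeasure_pos aτ bτ
    rw [← hprior.law_τ] at this
    exact ae_of_ae_map hmτ.aemeasurable this
  have hφ : ∀ᵐ ω ∂P, ∀ r, 0 < φ ω r := by
    have := ae_dirichletMeasure_pos (R := R) (a := fun _ => α) fun _ => hα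
    rw [← hprior.law_φ] at this
    exact ae_of_ae_map hmφ.aemeasurable this
  have hlam : ∀ᵐ l ∂(P.map lam), ∀ h r, 0 < l h r := by
    rw [hprior.law_lam]
    have := isProbabilityMeasure_gammaMeasure hal hbl
    exact Measure.ae_pi_of_forall_ae (p := fun _ (x : Fin R → ℝ) => ∀ r, 0 < x r) fun _ =>
      Measure.ae_pi_of_forall_ae (p := fun _ (x : ℝ) => 0 < x) fun _ => ae_gammaMeasure_pos al bl
  have hw : ∀ᵐ ω ∂P, ∀ h r p, 0 < w ω h r p := by
    have : ∀ᵐ x ∂(P.map fun ω => (lam ω, w ω)), ∀ h r p, 0 < x.2 h r p := by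
      rw [← compProd_map_condDistrib hmw.aemeasurable]
      refine (Measure.ae_compProd_iff (measurable_snd hw_meas)).2 ?_
      filter_upwards [hprior.law_w, hlam] with l hl hpos
      rw [hl]
      have := fun h r => isProbabilityMeasure_expMeasure
        (div_pos (pow_pos (hpos h r) 2) two_pos)
      exact Measure.ae_pi_of_forall_ae (p := fun h (x : Fin R → Fin (I h) → ℝ) => ∀ r p, 0 < x r p) fun h =>
        Measure.ae_pi_of_forall_ae (p := fun _ (x : Fin (I h) → ℝ) => ∀ p, 0 < x p) fun r =>
          Measure.ae_pi_of_forall_ae (p := fun _ (x : ℝ) => 0 < x) fun _ => ae_gammaMeasure_pos 1 _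
    exact ae_of_ae_map (hml.prodMk hmw).aemeasurable this
  have hset : MeasurableSet {θ : ℝ × (Fin R → ℝ) × LocalScales R I |
      0 < θ.1 ∧ (∀ r, 0 < θ.2.1 r) ∧ ∀ h r p, 0 < θ.2.2 h r p} :=
    (measurableSet_lt measurable_const measurable_fst).inter
      ((measurable_fst.comp measurable_snd hφ_meas).inter
        (measurable_snd.comp measurable_snd hw_meas))
  rw [ae_map_iff (hmτ.prodMk (hmφ.prodMk hmw)).aemeasurable hset]
  filter_upwards [hτ, hφ, hw] with ω h1 h2 h3 using ⟨h1, h2, h3⟩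

theorem lemma2 {Ω : Type*} [MeasurableSpace Ω] (P : Measure Ω) [IsProbabilityMeasure P]
    {R : ℕ} (hR : 0 < R) {I : Fin 4 → ℕ} {α aτ bτ al bl : ℝ}
    (hα : 0 < α) (haτ : 0 < aτ) (hbτ : 0 < bτ) (hal : 0 < al) (hbl : 0 < bl)
    (φ : Ω → Fin R → ℝ) (τ : Ω → ℝ) (lam : Ω → Fin 4 → Fin R → ℝ)
    (w : Ω → LocalScales R I) (β : Ω → ParafacMarginals R I)
    (hprior : IsGlobalLocalPrior P α aτ bτ al bl φ τ lam w β)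
    (m : (h : Fin 4) → Fin (I h)) (c : ℝ) (hc : 0 < c) :
    -- the Mellin-Barnes integral converges and is real and nonnegative
    (∀ y : ℝ, 0 < y →
      Complex.VerticalIntegrable (fun s => (y : ℂ) ^ (-s) *
        meijerKernel 4 0 (fun j : Fin 0 => j.elim0) (fun _ : Fin 4 => 0) s) c ∧
      (meijerG₄ c y).im = 0 ∧ 0 ≤ (meijerG₄ c y).re) ∧
    -- the conditional laws given `θ = (τ, φ, W)`
    ∀ᵐ θ ∂(P.map fun ω => (τ ω, φ ω, w ω)),
      (0 < θ.1 ∧ (∀ r, 0 < θ.2.1 r) ∧ ∀ h r p, 0 < θ.2.2 h r p) ∧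
      (∀ r, condDistrib (fun ω => parafacSummand m (β ω) r) (fun ω => (τ ω, φ ω, w ω)) P θ =
        volume.withDensity fun x => ENNReal.ofReal
          (productNormalDensity c (fun h => θ.1 * θ.2.1 r * θ.2.2 h r (m h)) x)) ∧
      condDistrib (fun ω => parafacEntry m (β ω)) (fun ω => (τ ω, φ ω, w ω)) P θ =
        measureConvList (List.ofFn fun r =>
          condDistrib (fun ω => parafacSummand m (β ω) r) (fun ω => (τ ω, φ ω, w ω)) P θ) ∧
      condDistrib (fun ω => parafacEntry m (β ω)) (fun ω => (τ ω, φ ω, w ω)) P θ =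
        volume.withDensity (densityConvList (List.ofFn fun r x => ENNReal.ofReal
          (productNormalDensity c (fun h => θ.1 * θ.2.1 r * θ.2.2 h r (m h)) x))) := by

  refine ⟨fun y hy => ⟨verticalIntegrable_cpow_mul_meijerKernel hc hy, ?_, ?_⟩, ?_⟩
  · rw [meijerG₄_eq hc hy, Complex.ofReal_im]
  · rw [meijerG₄_eq hc hy, Complex.ofReal_re]
    exact (continuousInvBounded_expMulConvPow 3).nonneg y hy
  have hmβ := hprior.measurable_β.aemeasurable (μ := P)
  have hsummand : ∀ᵐ θ ∂(P.map fun ω => (τ ω, φ ω, w ω)), ∀ r, _ := ae_all_iff.2 fun r =>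
    condDistrib_comp (fun ω => (τ ω, φ ω, w ω)) hmβ (measurable_parafacSummand m r)
  have hentry_meas : Measurable (parafacEntry m : ParafacMarginals R I → ℝ) :=
    Finset.measurable_sum _ fun r _ => measurable_parafacSummand m r
  have hentry : _ =ᵐ[P.map fun ω => (τ ω, φ ω, w ω)] _ :=
    condDistrib_comp (fun ω => (τ ω, φ ω, w ω)) hmβ hentry_meas
  have hsummand_meas : Measurable (parafacSummand m : ParafacMarginals R I → Fin R → ℝ) :=
    measurable_pi_lambda _ fun r => measurable_parafacSummand m r
  filter_upwards [hprior.ae_pos hα hal hbl, hsummand, hentry, hprior.law_β]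
    with θ hpos hs he hβ
  obtain ⟨hτ, hφ, hw⟩ := hpos
  set D : Fin R → ℝ → ℝ≥0∞ := fun r x => ENNReal.ofReal
    (productNormalDensity c (fun h => θ.1 * θ.2.1 r * θ.2.2 h r (m h)) x) with hD
  have hv : ∀ h r, 0 < θ.1 * θ.2.1 r * θ.2.2 h r (m h) := fun h r =>
    mul_pos (mul_pos hτ (hφ r)) (hw h r (m h))
  have hDm : ∀ r, AEMeasurable (D r) := fun r =>
    aemeasurable_ofReal_productNormalDensity hc fun h => hv h r
  have hlaw : (condDistrib β (fun ω => (τ ω, φ ω, w ω)) P θ).map (parafacSummand m) =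
      Measure.pi fun r => volume.withDensity (D r) := by
    rw [hβ]
    exact map_parafacSummand_pi_pi m hc _ hv fun h r =>
      map_multivariateGaussian_smul_diagonal (mul_pos hτ (hφ r)).le (fun i => (hw h r i).le) _
  have hDprob : ∀ r, IsProbabilityMeasure (volume.withDensity (D r)) := fun r => by
    rw [← map_prod_pi_gaussianReal_four hc fun h => hv h r]
    exact Measure.isProbabilityMeasure_map (by fun_prop)
  have hs' : ∀ r, condDistrib (fun ω => parafacSummand m (β ω) r)
      (fun ω => (τ ω, φ ω, w ω)) P θ = volume.withDensity (D r) := fun r => by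
    refine (hs r).trans ?_
    rw [Kernel.map_apply _ (measurable_parafacSummand m r),
      ← (measurePreserving_eval (fun r => volume.withDensity (D r)) r).map_eq, ← hlaw,
      Measure.map_map (measurable_pi_apply r) hsummand_meas]
    rfl
  have he' : condDistrib (fun ω => parafacEntry m (β ω)) (fun ω => (τ ω, φ ω, w ω)) P θ =
      measureConvList (List.ofFn fun r => volume.withDensity (D r)) := by
    refine he.trans ?_
    rw [Kernel.map_apply _ hentry_meas, ← map_sum_pi_eq_measureConvList, ← hlaw,
      Measure.map_map (by fun_prop) hsummand_meas]
    rfl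
  refine ⟨⟨hτ, hφ, hw⟩, hs', ?_, ?_⟩
  · simp only [hs']
    exact he'
  · rw [he', ← measureConvList_map_withDensity, List.map_ofFn]
    · rfl
    · intro f hf
      obtain ⟨r, rfl⟩ := (List.mem_ofFn' _ _).1 hf
      exact hDm r
    · simpa using hR.ne'
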